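/- Write $2^{<\omega}$ for the set of finite binary strings, $2^\omega$ for the set of infinite binary sequences, $[\![\sigma]\!]$ for the set of all $x\in2^\omega$ extending the string $\sigma$, and $x{\upharpoonright}n$ for the initial segment of $x$ of length $n$. For $p\in[0,1]$ let $\mu_p$ be the Bernoulli $p$-measure on $2^\omega$, $\mu_p(\sigma):=\mu_p([\![\sigma]\!])=p^{\#_0(\sigma)}(1-p)^{\#_1(\sigma)}$, where $\#_i(\sigma)$ is the number of occurrences of the bit $i$ in $\sigma$. As an oracle, $p$ is given by its binary expansion. Let $\mathsf{MLR}_{\mu_p}$ be the set of Bernoulli $p$-random sequences, i.e. of those $x\in2^\omega$ such that $x\notin\bigcap_i\mathcal U_i$ for every sequence $(\mathcal U_i)_{i\in\omega}$ of subsets of $2^\omega$ that is uniformly $\Sigma^0_1$ relative to $p$ and satisfies $\mu_p(\mathcal U_i)\le2^{-i}$ for all $i$. A semimeasure is a function $\delta:2^{<\omega}\to[0,1]$ with $\delta(\sigma)\ge\delta(\sigma0)+\delta(\sigma1)$ for all $\sigma\in2^{<\omega}$; it is left-c.e. if, uniformly in $\sigma$, $\delta(\sigma)$ is the limit of a computable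 nondecreasing sequence of rational numbers. A blind $p$-supermartingale is a function on $2^{<\omega}$ of the form $M=\delta/\mu_p$ with $\delta$ a left-c.e. semimeasure (no oracle), and $M$ succeeds on $x\in2^\omega$ if $\limsup_{n}M(x{\upharpoonright}n)=\infty$. **Theorem.** Let $p\in[0,1]$ satisfy $p\ge_T\emptyset'$, where $\emptyset'$ is the halting problem. Then there is some $y\in2^\omega$ with $y\notin\mathsf{MLR}_{\mu_p}$ such that no blind $p$-supermartingale succeeds on $y$. -/

import Mathlib

open MeasureTheory Filter Topology
open scoped ENNReal

namespace BlindBernoulli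

/-! Finite binary strings are `List Bool` and infinite binary sequences are `ℕ → Bool`
(product topology, Borel = product σ-algebra); `false` is the bit 0 and `true` is the bit 1. -/

/-- The initial segment of `x` of length `n`. -/
def restrict (x : ℕ → Bool) (n : ℕ) : List Bool := (List.range n).map x

/-- The basic clopen set of all sequences that extend the string `σ`. -/
def cylinder (σ : List Bool) : Set (ℕ → Bool) := {x | restrict x σ.length = σ}

/-! ### Computability -/

/-- A sequence, seen as a (total) number-theoretic function that can serve as an oracle. -/
def toOracle (z : ℕ → Bool) : ℕ →. ℕ := fun n => Part.some (z n).toNat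

/-- `S` is computably enumerable relative to `z`: it is the domain of a partial `z`-computable
function. -/
def CEIn {α : Type*} [Primcodable α] (z : ℕ → Bool) (S : Set α) : Prop :=
  ∃ f : α →. Unit, RecursiveIn {toOracle z} f ∧ ∀ a, a ∈ S ↔ (f a).Dom

open Classical in
/-- The (characteristic function of the) halting problem: the set of all `e` such that the
`e`-th partial computable function halts on input `e`. -/
noncomputable def emptyJump : ℕ → Bool :=
  fun e => decide ((Nat.Partrec.Code.eval (Denumerable.ofNat Nat.Partrec.Code e) e).Dom)

/-- The binary expansion of the fractional part of `p ≥ 0` (the one with infinitely many zeros).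
As an oracle it represents `p`; in particular `0` and `1` are represented by the computable
sequence of zeros. -/
noncomputable def binaryExpansion (p : ℝ) : ℕ → Bool :=
  fun n => decide (⌊p * 2 ^ (n + 1)⌋₊ % 2 = 1)

/-! ### Bernoulli measures and Martin-Löf randomness -/

/-- The Bernoulli `p`-measure on infinite binary sequences: the bits are independent, and each
of them is 0 with probability `p` and 1 with probability `1 - p`. -/
noncomputable def bernoulli (p : unitInterval) : Measure (ℕ → Bool) :=
  Measure.infinitePi fun _ => ProbabilityTheory.bernoulliMeasure false true p

theorem cylinder_eq_pi (σ : List Bool) : cylinder σ = Set.pi (Finset.range σ.length) (fun i => {σ.getD i false}) := by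
  ext x
  simp only [cylinder, restrict, Set.mem_ofPred_eq, Set.mem_pi, Finset.coe_range, Set.mem_Iio, Set.mem_singleton_iff]
  constructor
  · intro h i hi
    have := congrArg (fun l => l.getD i false) h
    simpa [hi] using this
  · intro h
    apply List.ext_getElem
    · simp
    · intro i h1 h2
      have := h i h2
      simpa [h2] using this

/-- The defining formula `μ_p σ = p ^ #₀(σ) * (1 - p) ^ #₁(σ)` of the Bernoulli measure. -/
theorem bernoulli_real_cylinder (p : unitInterval) (σ : List Bool) :
    (bernoulli p).real (cylinder σ) = (p:ℝ) ^ σ.count false * (1 - p) ^ σ.count true := by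
  rw [cylinder_eq_pi, bernoulli, Measure.real, Measure.infinitePi_pi _ (fun _ _ => MeasurableSet.singleton _), ENNReal.toReal_prod]
  have key : ∀ b, ((ProbabilityTheory.bernoulliMeasure false true p) {b}).toReal = if b then 1 - (p:ℝ) else p := by
    intro b
    cases b <;> simp [ProbabilityTheory.bernoulliMeasure_def]
  simp only [key]
  clear key
  induction σ with
  | nil => simp
  | cons b σ ih =>
    rw [List.length_cons, Finset.prod_range_succ']
    simp only [List.getD_cons_succ, List.getD_cons_zero] at ih ⊢
    rw [ih]
    cases b <;> simp [pow_succ] <;> ring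

/-- `U` is a `μ`-Martin-Löf test relative to `z`: a uniformly `Σ⁰₁` in `z` sequence of classes
with `μ (U i) ≤ 2⁻ⁱ`. -/
structure IsMLTest (μ : Measure (ℕ → Bool)) (z : ℕ → Bool) (U : ℕ → Set (ℕ → Bool)) : Prop where
  uniform : ∃ W : Set (ℕ × List Bool), CEIn z W ∧
    ∀ i, U i = {x | ∃ σ, (i, σ) ∈ W ∧ x ∈ cylinder σ}
  measure_le : ∀ i, μ (U i) ≤ (2⁻¹ : ℝ≥0∞) ^ i

/-- The sequences that are `μ`-Martin-Löf random relative to `z`. -/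
def MLR (μ : Measure (ℕ → Bool)) (z : ℕ → Bool) : Set (ℕ → Bool) :=
  {x | ∀ U, IsMLTest μ z U → x ∉ ⋂ i, U i}

/-- The Bernoulli `p`-random sequences: `μ_p`-Martin-Löf random relative to the parameter `p`. -/
noncomputable def BernoulliRandom (p : unitInterval) : Set (ℕ → Bool) :=
  MLR (bernoulli p) (binaryExpansion p)

/-! ### Semimeasures and blind supermartingales -/

/-- `ρ` is a semimeasure on finite strings. -/
structure IsSemimeasure (ρ : List Bool → ℝ) : Prop where
  mem_Icc : ∀ σ, ρ σ ∈ Set.Icc (0 : ℝ) 1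
  superadditive : ∀ σ, ρ (σ ++ [false]) + ρ (σ ++ [true]) ≤ ρ σ

/-- The nonnegative function `f` is left-c.e. uniformly in its argument: it is the pointwise limit
of a uniformly computable, nondecreasing sequence of rationals `num / (den + 1)`. (As `f` is
nonnegative, negative rationals in such a sequence can be replaced by 0.) -/
def IsLeftCE (f : List Bool → ℝ) : Prop :=
  ∃ num den : List Bool → ℕ → ℕ, Computable₂ num ∧ Computable₂ den ∧
    ∀ σ, Monotone (fun s => (num σ s : ℝ) / ((den σ s : ℝ) + 1)) ∧
      Tendsto (fun s => (num σ s : ℝ) / ((den σ s : ℝ) + 1)) atTop (𝓝 (f σ))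

/-- `M` is a blind `p`-supermartingale: the quotient `δ / μ_p` for a left-c.e. semimeasure `δ`,
where `μ_p σ` is the measure of the cylinder of `σ` (which is positive if `0 < p < 1`). -/
def IsBlindSupermartingale (p : unitInterval) (M : List Bool → ℝ) : Prop :=
  ∃ δ : List Bool → ℝ, IsSemimeasure δ ∧ IsLeftCE δ ∧
    ∀ σ, M σ = δ σ / (bernoulli p).real (cylinder σ)

/-- `M` succeeds on `x`: the limit superior of `M` along the initial segments of `x` is `∞`. -/
def Succeeds (M : List Bool → ℝ) (x : ℕ → Bool) : Prop :=
  limsup (fun n => (M (restrict x n) : EReal)) atTop = ⊤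

end BlindBernoulli

/-!
An oracle for the halting problem counts how many multiples of `b ^ (-|σ|)` lie below a left-c.e.
semimeasure `δ σ`, and so computes `δ` rounded up, uniformly in an index. It also recognises the
strings at which the function so obtained violates superadditivity by more than the rounding error;
cutting the function off there makes every index usable and changes no rounded semimeasure.

Hence the weighted mixture of all rounded left-c.e. semimeasures is computable in the halting
problem. With `p` as a further oracle, let `y` be the path that always moves to the child on which
the mixture is smaller relative to the conditional `μ_p`-probability. Along `y` the quotient of the
mixture by `μ_p` grows only through rounding errors. These are of order `b ^ (-n)` at length `n`,
whereas `μ_p` is at least `(2 / b) ^ n` once `b` is large, so the quotient stays bounded and no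
`δ / μ_p` succeeds on `y`. As `y` is computable in `p` and `μ_p` has no atoms, the initial segments
of `y` form a test that `y` fails.
-/

namespace BlindBernoulli

open Nat.Partrec (Code)
open Encodable

section OracleComputability

variable {α β γ σ : Type*} [Primcodable α] [Primcodable β] [Primcodable γ] [Primcodable σ]
  {O : Set (ℕ →. ℕ)}

theorem recursiveIn_comp {f : β →. σ} {g : α → β} (hf : RecursiveIn O f) (hg : ComputableIn O g) :
    RecursiveIn O fun a => f (g a) :=
  (Nat.RecursiveIn.comp hf hg).of_eq fun n => by
    simp only [Part.bind_eq_bind]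
    rcases decode (α := α) n with - | a <;> simp [encodek]

theorem computableIn_comp {f : β → σ} {g : α → β} (hf : ComputableIn O f)
    (hg : ComputableIn O g) : ComputableIn O fun a => f (g a) :=
  recursiveIn_comp (f := fun b => Part.some (f b)) hf hg

theorem computableIn_of_eq {f g : α → σ} (hf : ComputableIn O f) (h : ∀ a, f a = g a) :
    ComputableIn O g :=
  funext h ▸ hf

theorem computableIn_pair {f : α → β} {g : α → γ} (hf : ComputableIn O f)
    (hg : ComputableIn O g) : ComputableIn O fun a => (f a, g a) :=
  (Nat.RecursiveIn.pair hf hg).of_eq fun n => by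
    rcases decode (α := α) n with - | a <;> simp [Seq.seq]

theorem computableIn_comp₂ {f : β → γ → σ} {g : α → β} {h : α → γ} (hf : ComputableIn₂ O f)
    (hg : ComputableIn O g) (hh : ComputableIn O h) : ComputableIn O fun a => f (g a) (h a) :=
  computableIn_comp (f := fun q : β × γ => f q.1 q.2) hf (computableIn_pair hg hh)

theorem computableIn_primrec_comp {f : β → σ} {g : α → β} (hf : Primrec f)
    (hg : ComputableIn O g) : ComputableIn O fun a => f (g a) :=
  computableIn_comp hf.computableIn hg

theorem computableIn_primrec_comp₂ {f : β → γ → σ} {g : α → β} {h : α → γ} (hf : Primrec₂ f)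
    (hg : ComputableIn O g) (hh : ComputableIn O h) : ComputableIn O fun a => f (g a) (h a) :=
  computableIn_comp₂ hf.computableIn₂ hg hh

theorem natRecursiveIn_prec {f g h : ℕ →. ℕ} (hf : Nat.RecursiveIn O f)
    (hg : Nat.RecursiveIn O g) (hh : Nat.RecursiveIn O h) :
    Nat.RecursiveIn O fun a => (f a).bind fun n => n.rec (g a) fun y IH =>
      IH.bind fun i => h (Nat.pair a (Nat.pair y i)) :=
  ((Nat.RecursiveIn.prec hg hh).comp
    (Nat.RecursiveIn.pair (Nat.Partrec.recursiveIn Nat.Partrec.some) hf)).of_eq fun a =>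
    Part.ext fun s => by simp [Seq.seq]

theorem computableIn_nat_rec {f : α → ℕ} {g : α → σ} {h : α → ℕ × σ → σ}
    (hf : ComputableIn O f) (hg : ComputableIn O g) (hh : ComputableIn₂ O h) :
    ComputableIn O fun a => Nat.rec (motive := fun _ => σ) (g a) (fun n s => h a (n, s)) (f a) :=
  (natRecursiveIn_prec hf hg hh).of_eq fun n => by
    rcases hn : decode (α := α) n with - | a
    · simp
    · simp only [Part.coe_some, Part.bind_some, Part.map_some, encode_nat]
      induction f a with
      | zero => simp
      | succ m ih =>
        simp only [ih, Part.bind_some]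
        simp [hn, encodek]

theorem computableIn_ite {c : α → Prop} [DecidablePred c] {f g : α → σ}
    (hc : ComputableIn O fun a => decide (c a)) (hf : ComputableIn O f) (hg : ComputableIn O g) :
    ComputableIn O fun a => if c a then f a else g a :=
  computableIn_of_eq (computableIn_nat_rec (h := fun a _ => f a)
    (computableIn_primrec_comp (Primrec.dom_finite Bool.toNat) hc) hg
    (computableIn_comp hf ComputableIn.fst)) fun a => by by_cases h : c a <;> simp [h]

theorem computableIn_sum_range {f : α → ℕ} {g : α → ℕ → ℕ} (hf : ComputableIn O f)
    (hg : ComputableIn₂ O g) : ComputableIn O fun a => ∑ i ∈ Finset.range (f a), g a i :=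
  computableIn_of_eq (computableIn_nat_rec (h := fun a q => q.2 + g a q.1) hf
    (ComputableIn.const 0) (computableIn_primrec_comp₂ Primrec.nat_add
      (computableIn_comp ComputableIn.snd ComputableIn.snd)
      (computableIn_comp₂ hg ComputableIn.fst
        (computableIn_comp ComputableIn.fst ComputableIn.snd)))) fun a => by
    induction f a with
    | zero => rfl
    | succ n ih => rw [Finset.sum_range_succ, ← ih]

theorem computableIn_count {f : α → ℕ} {g : α → ℕ → Bool} (hf : ComputableIn O f)
    (hg : ComputableIn₂ O g) : ComputableIn O fun a => Nat.count (fun i => g a i = true) (f a) :=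
  computableIn_of_eq (computableIn_sum_range (g := fun a i => (g a i).toNat) hf
    (computableIn_primrec_comp (Primrec.dom_finite Bool.toNat) hg)) fun a => by
    rw [Nat.count_eq_card_filter_range, Finset.card_filter]
    exact Finset.sum_congr rfl fun i _ => by cases g a i <;> rfl

theorem computableIn_decide_forall_lt {f : α → ℕ} {r : α → ℕ → Prop} [DecidableRel r]
    (hf : ComputableIn O f) (hr : ComputableIn₂ O fun a i => decide (r a i)) :
    ComputableIn O fun a => decide (∀ i < f a, r a i) :=
  computableIn_of_eq (computableIn_nat_rec (h := fun a q => q.2 && decide (r a q.1)) hf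
    (ComputableIn.const true) (computableIn_primrec_comp₂ Primrec.and
      (computableIn_comp ComputableIn.snd ComputableIn.snd)
      (computableIn_comp₂ hr ComputableIn.fst
        (computableIn_comp ComputableIn.fst ComputableIn.snd)))) fun a => by
    induction f a with
    | zero => simp
    | succ n ih => simp only [ih, Nat.forall_lt_succ_right, Bool.decide_and]

theorem computableIn_length {f : α → List β} (hf : ComputableIn O f) :
    ComputableIn O fun a => (f a).length :=
  computableIn_primrec_comp Primrec.list_length hf

theorem computableIn_pow {f g : α → ℕ} (hf : ComputableIn O f) (hg : ComputableIn O g) :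
    ComputableIn O fun a => f a ^ g a :=
  computableIn_primrec_comp₂ (Primrec₂.unpaired'.1 Nat.Primrec.pow) hf hg

theorem computableIn_append {f : α → List β} {g : α → β} (hf : ComputableIn O f)
    (hg : ComputableIn O g) : ComputableIn O fun a => f a ++ [g a] :=
  computableIn_primrec_comp₂ (f := fun (l : List β) b => l ++ [b]) Primrec.list_concat hf hg

theorem recursiveIn_toOracle_iff {z : ℕ → Bool} :
    RecursiveIn O (toOracle z) ↔ ComputableIn O z := by
  rw [RecursiveIn.iff_nat]
  refine iff_of_eq (congrArg (Nat.RecursiveIn O) (funext fun n => ?_))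
  cases h : z n <;> simp [toOracle, h]

theorem ceIn_of_computableIn {z : ℕ → Bool} {S : Set α} [DecidablePred (· ∈ S)]
    (hS : ComputableIn {toOracle z} fun a => decide (a ∈ S)) : CEIn z S := by
  have hif : Partrec fun b : Bool => (bif b then Part.some () else Part.none : Part Unit) :=
    Partrec.cond Computable.id (Partrec.some.comp (Computable.const ())) Partrec.none
  refine ⟨_, recursiveIn_comp hif.recursiveIn hS, fun a => ?_⟩
  by_cases ha : a ∈ S <;> simp [ha]

end OracleComputability

/-! ### The halting problem as an oracle -/

/-- Whether the `e`-th partial computable function halts on input `x`. -/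
noncomputable def haltsOn (e x : ℕ) : Bool :=
  emptyJump (encode (Code.comp (Denumerable.ofNat Code e) (Code.const x)))

theorem haltsOn_eq_true_iff {e x : ℕ} :
    haltsOn e x = true ↔ (Code.eval (Denumerable.ofNat Code e) x).Dom := by
  simp only [haltsOn, emptyJump, Denumerable.ofNat_encode, Code.eval, decide_eq_true_eq,
    Code.eval_const]
  exact iff_of_eq (congrArg Part.Dom (Part.bind_some x _))

theorem computableIn_haltsOn {O : Set (ℕ →. ℕ)} (h : ComputableIn O emptyJump) :
    ComputableIn₂ O haltsOn :=
  computableIn_comp h (Primrec.encode.comp (Code.primrec₂_comp.comp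
    ((Primrec.ofNat Code).comp Primrec.fst) (Code.primrec_const.comp Primrec.snd))).computableIn

theorem exists_haltsOn_iff {α : Type*} [Primcodable α] {r : α → Prop} (hr : REPred r) :
    ∃ e, ∀ a, haltsOn e (encode a) = true ↔ r a := by
  obtain ⟨code, hcode⟩ := Code.exists_code.1 hr
  refine ⟨encode code, fun a => ?_⟩
  rw [haltsOn_eq_true_iff, Denumerable.ofNat_encode, hcode]
  simp [encodek, Part.assert]

theorem not_computable_emptyJump : ¬ Computable emptyJump := by
  intro h
  have hhalts : Computable₂ haltsOn :=
    recursiveIn_empty_iff.1 (computableIn_haltsOn (recursiveIn_empty_iff.2 h))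
  refine ComputablePred.halting_problem 0 (ComputablePred.computable_iff.2
    ⟨fun c => haltsOn (encode c) 0, hhalts.comp Computable.encode (Computable.const 0), ?_⟩)
  ext c
  simp only [haltsOn_eq_true_iff, Denumerable.ofNat_encode]

theorem binaryExpansion_natCast (m : ℕ) : binaryExpansion m = fun _ => false := by
  funext n
  have heven : (m : ℝ) * 2 ^ (n + 1) = ((m * 2 ^ n * 2 : ℕ) : ℝ) := by push_cast; ring
  rw [binaryExpansion, heven, Nat.floor_natCast]
  simp

theorem mem_Ioo_of_emptyJump_le {p : unitInterval}
    (hp : TuringReducible (toOracle emptyJump) (toOracle (binaryExpansion p))) :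
    (p : ℝ) ∈ Set.Ioo (0 : ℝ) 1 := by
  have hne (m : ℕ) : (p : ℝ) ≠ m := fun hm => by
    rw [hm, binaryExpansion_natCast] at hp
    exact not_computable_emptyJump
      (RecursiveIn.partrec_of_const (s := 0) (recursiveIn_toOracle_iff.1 hp))
  exact ⟨p.2.1.lt_of_ne' (by simpa using hne 0), p.2.2.lt_of_ne (by simpa using hne 1)⟩

theorem floor_mul_two_pow_succ (x : ℝ) (n : ℕ) :
    ⌊x * 2 ^ (n + 1)⌋₊ = 2 * ⌊x * 2 ^ n⌋₊ + (binaryExpansion x n).toNat := by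
  have hhalf : ⌊x * 2 ^ n⌋₊ = ⌊x * 2 ^ (n + 1)⌋₊ / 2 := by
    rw [← Nat.floor_div_ofNat, pow_succ, ← mul_assoc, mul_div_assoc]
    norm_num
  have hbit : (binaryExpansion x n).toNat = ⌊x * 2 ^ (n + 1)⌋₊ % 2 := by
    unfold binaryExpansion
    rcases Nat.mod_two_eq_zero_or_one ⌊x * 2 ^ (n + 1)⌋₊ with h | h <;> simp [h]
  rw [hhalf, hbit, Nat.div_add_mod]

theorem computableIn_floor_mul_two_pow {O : Set (ℕ →. ℕ)} {x : ℝ}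
    (h : ComputableIn O (binaryExpansion x)) : ComputableIn O fun n : ℕ => ⌊x * 2 ^ n⌋₊ :=
  computableIn_of_eq (computableIn_nat_rec
    (h := fun _ q => 2 * q.2 + (binaryExpansion x q.1).toNat) ComputableIn.id
    (ComputableIn.const ⌊x⌋₊) (computableIn_primrec_comp₂ Primrec.nat_add
      (computableIn_primrec_comp₂ Primrec.nat_mul (ComputableIn.const 2)
        (computableIn_comp ComputableIn.snd ComputableIn.snd))
      (computableIn_primrec_comp (Primrec.dom_finite Bool.toNat)
        (computableIn_comp h (computableIn_comp ComputableIn.fst ComputableIn.snd)))))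
    fun n => by
    induction n with
    | zero => simp
    | succ n ih => rw [floor_mul_two_pow_succ, ← ih]; rfl

/-! ### Sequences produced by a prediction strategy -/

theorem restrict_succ (x : ℕ → Bool) (n : ℕ) : restrict x (n + 1) = restrict x n ++ [x n] := by
  simp [restrict, List.range_succ]

@[simp] theorem length_restrict (x : ℕ → Bool) (n : ℕ) : (restrict x n).length = n := by
  simp [restrict]

theorem computableIn_restrict {O : Set (ℕ →. ℕ)} {x : ℕ → Bool} (hx : ComputableIn O x) :
    ComputableIn O (restrict x) :=
  computableIn_of_eq (computableIn_nat_rec (h := fun _ q => q.2 ++ [x q.1]) ComputableIn.id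
    (ComputableIn.const []) (computableIn_append
      (computableIn_comp ComputableIn.snd ComputableIn.snd)
      (computableIn_comp hx (computableIn_comp ComputableIn.fst ComputableIn.snd)))) fun n => by
    induction n with
    | zero => rfl
    | succ n ih => rw [restrict_succ, ← ih]; rfl

/-- The string of length `n` obtained by starting from the empty string and repeatedly appending
the bit that `next` assigns to the string built so far. -/
def iterateAppend (next : List Bool → Bool) : ℕ → List Bool
  | 0 => []
  | n + 1 => iterateAppend next n ++ [next (iterateAppend next n)]

/-- The infinite sequence whose every bit is the one that `next` assigns to the preceding ones. -/
def follow (next : List Bool → Bool) (n : ℕ) : Bool := next (iterateAppend next n)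

theorem restrict_follow (next : List Bool → Bool) (n : ℕ) :
    restrict (follow next) n = iterateAppend next n := by
  induction n with
  | zero => rfl
  | succ n ih => rw [restrict_succ, ih, iterateAppend, follow]

theorem follow_apply (next : List Bool → Bool) (n : ℕ) :
    follow next n = next (restrict (follow next) n) := by
  rw [restrict_follow, follow]

theorem computableIn_follow {O : Set (ℕ →. ℕ)} {next : List Bool → Bool}
    (h : ComputableIn O next) : ComputableIn O (follow next) := by
  have hlast : ComputableIn O fun q : ℕ × ℕ × List Bool => q.2.2 :=
    computableIn_comp ComputableIn.snd ComputableIn.snd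
  have hiterate : ComputableIn O (iterateAppend next) :=
    computableIn_of_eq (computableIn_nat_rec
      (h := fun _ q => q.2 ++ [next q.2]) ComputableIn.id (ComputableIn.const [])
      (computableIn_append hlast (computableIn_comp h hlast))) fun n => by
      induction n with
      | zero => rfl
      | succ n ih => rw [iterateAppend, ← ih]; rfl
  exact computableIn_comp (f := next) (g := iterateAppend next) h hiterate

/-! ### Bernoulli measures of cylinders -/

theorem bernoulli_real_cylinder_append (p : unitInterval) (σ : List Bool) (β : Bool) :
    (bernoulli p).real (cylinder (σ ++ [β])) =
      (bernoulli p).real (cylinder σ) * (if β then 1 - (p : ℝ) else p) := by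
  simp only [bernoulli_real_cylinder]
  cases β <;> simp [pow_succ] <;> ring

theorem bernoulli_bit_nonneg (p : unitInterval) (β : Bool) :
    0 ≤ if β then 1 - (p : ℝ) else p := by
  split_ifs
  exacts [sub_nonneg.2 p.2.2, p.2.1]

theorem pow_length_le_bernoulli_real_cylinder {p : unitInterval} {m : ℝ} (hm : 0 ≤ m)
    (h0 : m ≤ p) (h1 : m ≤ 1 - p) (σ : List Bool) :
    m ^ σ.length ≤ (bernoulli p).real (cylinder σ) := by
  rw [bernoulli_real_cylinder, ← List.count_false_add_count_true σ, pow_add]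
  have := hm.trans h0
  gcongr

theorem one_div_pow_length_le {b : ℕ} {p : unitInterval} (h0 : 2 / (b : ℝ) ≤ p)
    (h1 : 2 / (b : ℝ) ≤ 1 - p) (σ : List Bool) :
    1 / (b : ℝ) ^ σ.length ≤ (1 / 2) ^ σ.length * (bernoulli p).real (cylinder σ) :=
  calc 1 / (b : ℝ) ^ σ.length
    _ = (1 / 2) ^ σ.length * (2 / b) ^ σ.length := by
      rw [← mul_pow, ← one_div_pow]
      congr 1
      ring
    _ ≤ (1 / 2) ^ σ.length * (bernoulli p).real (cylinder σ) := by
      gcongr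
      exact pow_length_le_bernoulli_real_cylinder (by positivity) h0 h1 σ

theorem bernoulli_real_cylinder_le_pow_length {p : unitInterval} {r : ℝ} (h0 : (p : ℝ) ≤ r)
    (h1 : 1 - (p : ℝ) ≤ r) (σ : List Bool) :
    (bernoulli p).real (cylinder σ) ≤ r ^ σ.length := by
  have hp := p.2.1
  have hq := sub_nonneg.2 p.2.2
  have hr := hp.trans h0
  rw [bernoulli_real_cylinder, ← List.count_false_add_count_true σ, pow_add]
  gcongr

theorem bernoulli_real_cylinder_pos {p : unitInterval} (hp : (p : ℝ) ∈ Set.Ioo (0 : ℝ) 1)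
    (σ : List Bool) : 0 < (bernoulli p).real (cylinder σ) := by
  have hp0 := hp.1
  have hp1 := sub_pos.2 hp.2
  rw [bernoulli_real_cylinder]
  positivity

theorem not_mem_MLR_of_measure_cylinder_restrict_le {μ : Measure (ℕ → Bool)} {z y : ℕ → Bool}
    {g : ℕ → ℕ} (hy : ComputableIn {toOracle z} y) (hg : ComputableIn {toOracle z} g)
    (hμ : ∀ i, μ (cylinder (restrict y (g i))) ≤ (2⁻¹ : ℝ≥0∞) ^ i) : y ∉ MLR μ z := by
  intro hrandom
  refine hrandom (fun i => cylinder (restrict y (g i)))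
    ⟨⟨{q | q.2 = restrict y (g q.1)}, ceIn_of_computableIn ?_, fun i => ?_⟩, hμ⟩ ?_
  · exact computableIn_primrec_comp₂ Primrec.eq.decide ComputableIn.snd
      (computableIn_comp (computableIn_restrict hy) (computableIn_comp hg ComputableIn.fst))
  · simp
  · simp [cylinder]

theorem not_mem_MLR_bernoulli_of_computableIn {p : unitInterval}
    (hp : (p : ℝ) ∈ Set.Ioo (0 : ℝ) 1) {z y : ℕ → Bool} (hy : ComputableIn {toOracle z} y) :
    y ∉ MLR (bernoulli p) z := by
  set r : ℝ := max (p : ℝ) (1 - p)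
  have hr0 : 0 ≤ r := hp.1.le.trans (le_max_left _ _)
  have hr1 : r < 1 := max_lt hp.2 (sub_lt_self 1 hp.1)
  obtain ⟨k, hk⟩ := exists_pow_lt_of_lt_one (show (0 : ℝ) < 2⁻¹ by norm_num) hr1
  refine not_mem_MLR_of_measure_cylinder_restrict_le (g := fun i => k * i) hy
    (Primrec.nat_mul.comp (Primrec.const k) Primrec.id).computableIn fun i => ?_
  have hfinite : bernoulli p (cylinder (restrict y (k * i))) ≠ ∞ := by
    unfold bernoulli
    exact measure_ne_top _ _
  rw [← ENNReal.toReal_le_toReal hfinite (by finiteness), ENNReal.toReal_pow,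
    ENNReal.toReal_inv, ENNReal.toReal_ofNat]
  calc (bernoulli p).real (cylinder (restrict y (k * i)))
    _ ≤ r ^ (k * i) := by
      simpa using bernoulli_real_cylinder_le_pow_length (le_max_left _ _) (le_max_right _ _)
        (restrict y (k * i))
    _ = (r ^ k) ^ i := pow_mul r k i
    _ ≤ 2⁻¹ ^ i := by gcongr

/-! ### Rounded semimeasures -/

/-- Superadditivity at `τ` of the function `σ ↦ c σ / b ^ |σ|`, up to the error that rounding the
values of a semimeasure up to multiples of `b ^ (-|σ|)` can introduce: the two values at the
children of `τ` grow by less than one unit each. -/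
def SuperadditiveAt (b : ℕ) (c : List Bool → ℕ) (τ : List Bool) : Prop :=
  c (τ ++ [false]) + c (τ ++ [true]) ≤ b * c τ + 2

instance (b : ℕ) (c : List Bool → ℕ) (τ : List Bool) : Decidable (SuperadditiveAt b c τ) :=
  inferInstanceAs (Decidable (_ ≤ _))

/-- `σ ↦ c σ / b ^ |σ|` is a semimeasure up to rounding: the integer `c σ` represents the number
`c σ / b ^ |σ|`. -/
structure IsRoundedSemimeasure (b : ℕ) (c : List Bool → ℕ) : Prop where
  le_pow : ∀ σ, c σ ≤ b ^ σ.length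
  superadditiveAt : ∀ τ, SuperadditiveAt b c τ

/-- The function `f` rounded up to a multiple of `b ^ (-|σ|)`, given as the multiplier. -/
noncomputable def roundUp (b : ℕ) (f : List Bool → ℝ) (σ : List Bool) : ℕ :=
  ⌈(b : ℝ) ^ σ.length * f σ⌉₊

theorem isRoundedSemimeasure_roundUp (b : ℕ) {δ : List Bool → ℝ} (hδ : IsSemimeasure δ) :
    IsRoundedSemimeasure b (roundUp b δ) where
  le_pow σ := by
    rw [roundUp, Nat.ceil_le]
    push_cast
    exact mul_le_of_le_one_right (by positivity) (hδ.mem_Icc σ).2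
  superadditiveAt τ := by
    have hlt (σ : List Bool) : (roundUp b δ σ : ℝ) < b ^ σ.length * δ σ + 1 :=
      Nat.ceil_lt_add_one (mul_nonneg (by positivity) (hδ.mem_Icc σ).1)
    have hlt0 := hlt (τ ++ [false])
    have hlt1 := hlt (τ ++ [true])
    simp only [List.length_append, List.length_singleton] at hlt0 hlt1
    have hreal : (roundUp b δ (τ ++ [false]) : ℝ) + roundUp b δ (τ ++ [true]) ≤
        b * roundUp b δ τ + 2 := by
      calc (roundUp b δ (τ ++ [false]) : ℝ) + roundUp b δ (τ ++ [true])
        _ ≤ b ^ (τ.length + 1) * (δ (τ ++ [false]) + δ (τ ++ [true])) + 2 := by linarith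
        _ ≤ b ^ (τ.length + 1) * δ τ + 2 := by gcongr; exact hδ.superadditive τ
        _ = b * (b ^ τ.length * δ τ) + 2 := by ring
        _ ≤ b * roundUp b δ τ + 2 := by gcongr; exact Nat.le_ceil _
    unfold SuperadditiveAt
    exact_mod_cast hreal

/-- The function `c`, replaced by `0` beyond every string at which superadditivity fails. -/
def trim (b : ℕ) (c : List Bool → ℕ) (σ : List Bool) : ℕ :=
  if ∀ i < σ.length, SuperadditiveAt b c (σ.take i) then c σ else 0

theorem trim_le (b : ℕ) (c : List Bool → ℕ) (σ : List Bool) : trim b c σ ≤ c σ := by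
  unfold trim
  split_ifs <;> simp

theorem forall_take_append_iff {r : List Bool → Prop} {σ : List Bool} {β : Bool} :
    (∀ i < (σ ++ [β]).length, r ((σ ++ [β]).take i)) ↔
      (∀ i < σ.length, r (σ.take i)) ∧ r σ := by
  rw [List.length_append, List.length_singleton, Nat.forall_lt_succ_right, List.take_left]
  refine and_congr_left' (forall₂_congr fun i hi => ?_)
  rw [List.take_append_of_le_length hi.le]

theorem isRoundedSemimeasure_trim {b : ℕ} {c : List Bool → ℕ} (hc : ∀ σ, c σ ≤ b ^ σ.length) :
    IsRoundedSemimeasure b (trim b c) where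
  le_pow σ := (trim_le b c σ).trans (hc σ)
  superadditiveAt τ := by
    have hchild (β : Bool) : trim b c (τ ++ [β]) =
        if (∀ i < τ.length, SuperadditiveAt b c (τ.take i)) ∧ SuperadditiveAt b c τ
        then c (τ ++ [β]) else 0 :=
      if_congr forall_take_append_iff rfl rfl
    rw [SuperadditiveAt, hchild, hchild, trim]
    split_ifs with hτ hprefix hprefix
    · exact hτ.2
    · exact absurd hτ.1 hprefix
    all_goals simp

theorem trim_eq_self {b : ℕ} {c : List Bool → ℕ} (hc : IsRoundedSemimeasure b c) :
    trim b c = c :=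
  funext fun σ => if_pos fun i _ => hc.superadditiveAt (σ.take i)

theorem computableIn_decide_superadditiveAt {O : Set (ℕ →. ℕ)} {c : ℕ → List Bool → ℕ} (b : ℕ)
    (hc : ComputableIn₂ O c) :
    ComputableIn₂ O fun e τ => decide (SuperadditiveAt b (c e) τ) := by
  have hchild (β : Bool) : ComputableIn O fun q : ℕ × List Bool => c q.1 (q.2 ++ [β]) :=
    computableIn_comp₂ hc ComputableIn.fst
      (computableIn_append ComputableIn.snd (ComputableIn.const β))
  exact computableIn_primrec_comp₂ (f := fun m n : ℕ => decide (m ≤ n)) Primrec.nat_le.decide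
    (computableIn_primrec_comp₂ Primrec.nat_add (hchild false) (hchild true))
    (computableIn_primrec_comp₂ Primrec.nat_add
      (computableIn_primrec_comp₂ Primrec.nat_mul (ComputableIn.const b) hc)
      (ComputableIn.const 2))

theorem computableIn_trim {O : Set (ℕ →. ℕ)} {c : ℕ → List Bool → ℕ} (b : ℕ)
    (hc : ComputableIn₂ O c) : ComputableIn₂ O fun e => trim b (c e) := by
  have htake : ComputableIn O fun a : (ℕ × List Bool) × ℕ => a.1.2.take a.2 :=
    computableIn_primrec_comp₂ Primrec.list_take ComputableIn.snd
      (computableIn_comp ComputableIn.snd ComputableIn.fst)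
  have hsuper : ComputableIn₂ O fun (q : ℕ × List Bool) i =>
      decide (SuperadditiveAt b (c q.1) (q.2.take i)) :=
    computableIn_comp₂ (f := fun e τ => decide (SuperadditiveAt b (c e) τ))
      (g := fun a : (ℕ × List Bool) × ℕ => a.1.1) (computableIn_decide_superadditiveAt b hc)
      (computableIn_comp ComputableIn.fst ComputableIn.fst) htake
  have hprefix : ComputableIn O fun q : ℕ × List Bool =>
      decide (∀ i < q.2.length, SuperadditiveAt b (c q.1) (q.2.take i)) :=
    computableIn_decide_forall_lt
      (r := fun (q : ℕ × List Bool) i => SuperadditiveAt b (c q.1) (q.2.take i))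
      (computableIn_length ComputableIn.snd) hsuper
  exact computableIn_ite
    (c := fun q : ℕ × List Bool => ∀ i < q.2.length, SuperadditiveAt b (c q.1) (q.2.take i))
    (f := fun q => c q.1 q.2) hprefix hc (ComputableIn.const 0)

/-! ### Enumerating the left-c.e. semimeasures -/

theorem rePred_lt_pow_mul {f : List Bool → ℝ} (hf : IsLeftCE f) (b : ℕ) (hb : 0 < b) :
    REPred fun q : List Bool × ℕ => (q.2 : ℝ) < b ^ q.1.length * f q.1 := by
  obtain ⟨num, den, hnum, hden, hlim⟩ := hf
  let t (q : List Bool × ℕ) (s : ℕ) : Bool :=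
    decide (q.2 * (den q.1 s + 1) < b ^ q.1.length * num q.1 s)
  have ht : Computable₂ t := by
    have hstage {g : List Bool → ℕ → ℕ} (hg : Computable₂ g) :
        ComputableIn {} fun q : (List Bool × ℕ) × ℕ => g q.1.1 q.2 :=
      computableIn_comp₂ (recursiveIn_empty_iff.2 hg)
        (computableIn_comp ComputableIn.fst ComputableIn.fst) ComputableIn.snd
    exact recursiveIn_empty_iff.1 (computableIn_primrec_comp₂ Primrec.nat_lt.decide
      (computableIn_primrec_comp₂ Primrec.nat_mul
        (computableIn_comp ComputableIn.snd ComputableIn.fst)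
        (computableIn_primrec_comp Primrec.succ (hstage hden)))
      (computableIn_primrec_comp₂ Primrec.nat_mul
        (computableIn_pow (ComputableIn.const b) (computableIn_length
          (computableIn_comp ComputableIn.fst ComputableIn.fst))) (hstage hnum)))
  have ht_iff (σ : List Bool) (k s : ℕ) : t (σ, k) s = true ↔
      (k : ℝ) / b ^ σ.length < (num σ s : ℝ) / ((den σ s : ℝ) + 1) := by
    rw [div_lt_div_iff₀ (by positivity) (by positivity), mul_comm (num σ s : ℝ)]
    simp only [t, decide_eq_true_eq]
    exact_mod_cast Iff.rfl
  refine (Partrec.rfind ht.partrec₂).dom_re.of_eq fun ⟨σ, k⟩ => ?_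
  have hexists : (Nat.rfind fun s => Part.some (t (σ, k) s)).Dom ↔ ∃ s, t (σ, k) s = true := by
    refine Nat.rfind_dom'.trans ⟨fun ⟨s, hs, _⟩ => ⟨s, (Part.mem_some_iff.1 hs).symm⟩,
      fun ⟨s, hs⟩ => ⟨s, Part.mem_some_iff.2 hs.symm, fun _ => ⟨⟩⟩⟩
  refine hexists.trans ?_
  simp only [ht_iff]
  rw [← div_lt_iff₀' (by positivity)]
  constructor
  · rintro ⟨s, hs⟩
    exact hs.trans_le ((hlim σ).1.ge_of_tendsto (hlim σ).2 s)
  · intro hlt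
    exact ((hlim σ).2.eventually (lt_mem_nhds hlt)).exists

theorem count_eq_ceil {r : ℕ → Prop} [DecidablePred r] {x : ℝ} {n : ℕ} (hx : x ≤ n)
    (hr : ∀ k, r k ↔ (k : ℝ) < x) : Nat.count r n = ⌈x⌉₊ := by
  have hfilter : (Finset.range n).filter r = Finset.range ⌈x⌉₊ := by
    ext k
    simp only [Finset.mem_filter, Finset.mem_range, hr, Nat.lt_ceil, and_iff_right_iff_imp]
    exact fun hk => by exact_mod_cast hk.trans_le hx
  rw [Nat.count_eq_card_filter_range, hfilter, Finset.card_range]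

/-- The number of `k < b ^ |σ|` such that `(σ, k)` belongs to the `e`-th c.e. set. If that set
consists of the pairs with `k < b ^ |σ| * δ σ`, this is `b ^ |σ| * δ σ` rounded up. -/
noncomputable def countBelow (b e : ℕ) (σ : List Bool) : ℕ :=
  Nat.count (fun k => haltsOn e (encode (σ, k)) = true) (b ^ σ.length)

theorem countBelow_le (b e : ℕ) (σ : List Bool) : countBelow b e σ ≤ b ^ σ.length :=
  Nat.count_le _

theorem computableIn_countBelow {O : Set (ℕ →. ℕ)} (h : ComputableIn O emptyJump) (b : ℕ) :
    ComputableIn₂ O (countBelow b) :=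
  computableIn_count (g := fun (q : ℕ × List Bool) k => haltsOn q.1 (encode (q.2, k)))
    (computableIn_pow (ComputableIn.const b) (computableIn_length ComputableIn.snd))
    (computableIn_comp₂ (computableIn_haltsOn h)
      (computableIn_comp ComputableIn.fst ComputableIn.fst)
      (Primrec.encode.comp ((Primrec.snd.comp Primrec.fst).pair Primrec.snd)).computableIn)

theorem exists_countBelow_eq_roundUp {b : ℕ} (hb : 0 < b) {δ : List Bool → ℝ}
    (hδ : IsSemimeasure δ) (hce : IsLeftCE δ) : ∃ e, countBelow b e = roundUp b δ := by
  obtain ⟨e, he⟩ := exists_haltsOn_iff (rePred_lt_pow_mul hce b hb)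
  refine ⟨e, funext fun σ => count_eq_ceil ?_ fun k => he (σ, k)⟩
  push_cast
  exact mul_le_of_le_one_right (by positivity) (hδ.mem_Icc σ).2

/-! ### Mixtures -/

/-- The mixture `∑ e < |σ|, b ^ (-e) * ρ e σ` of the functions `ρ e σ = d e σ / b ^ |σ|`,
multiplied by `b ^ (2 * |σ|)` to make it an integer. The `e`-th function takes part only from
length `e + 1` on, which keeps the sum finite. -/
def mixture (b : ℕ) (d : ℕ → List Bool → ℕ) (σ : List Bool) : ℕ :=
  ∑ e ∈ Finset.range σ.length, b ^ (σ.length - e) * d e σ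

theorem computableIn_mixture {O : Set (ℕ →. ℕ)} {d : ℕ → List Bool → ℕ} (b : ℕ)
    (hd : ComputableIn₂ O d) : ComputableIn O (mixture b d) :=
  computableIn_sum_range (g := fun σ e => b ^ (σ.length - e) * d e σ)
    (computableIn_length ComputableIn.id)
    (computableIn_primrec_comp₂ Primrec.nat_mul
      (computableIn_pow (ComputableIn.const b) (computableIn_primrec_comp₂ Primrec.nat_sub
        (computableIn_length ComputableIn.fst) ComputableIn.snd))
      (computableIn_comp₂ hd ComputableIn.snd ComputableIn.fst))

theorem pow_mul_le_mixture (b : ℕ) (d : ℕ → List Bool → ℕ) {e : ℕ} {σ : List Bool}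
    (he : e < σ.length) : b ^ (σ.length - e) * d e σ ≤ mixture b d σ :=
  Finset.single_le_sum (f := fun e => b ^ (σ.length - e) * d e σ) (fun _ _ => Nat.zero_le _)
    (Finset.mem_range.2 he)

theorem mixture_append (b : ℕ) (d : ℕ → List Bool → ℕ) (σ : List Bool) (β : Bool) :
    mixture b d (σ ++ [β]) =
      b * ∑ e ∈ Finset.range (σ.length + 1), b ^ (σ.length - e) * d e (σ ++ [β]) := by
  rw [mixture, List.length_append, List.length_singleton, Finset.mul_sum]
  refine Finset.sum_congr rfl fun e he => ?_
  rw [Nat.sub_add_comm (Nat.lt_succ_iff.1 (Finset.mem_range.1 he)), pow_succ']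
  ring

theorem sum_range_pow_sub_le {b : ℕ} (hb : 2 ≤ b) (n : ℕ) :
    ∑ e ∈ Finset.range n, b ^ (n - e) ≤ 2 * b ^ n := by
  have hreflect : ∑ e ∈ Finset.range n, b ^ (n - e) = ∑ i ∈ Finset.range n, b ^ (i + 1) := by
    rw [← Finset.sum_range_reflect]
    refine Finset.sum_congr rfl fun i hi => ?_
    have := Finset.mem_range.1 hi
    congr 1
    omega
  rw [hreflect]
  clear hreflect
  induction n with
  | zero => simp
  | succ n ih =>
    rw [Finset.sum_range_succ, pow_succ]
    nlinarith [Nat.mul_le_mul_left (b ^ n) hb]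

section

variable {b : ℕ} {d : ℕ → List Bool → ℕ}

theorem mixture_le (hb : 2 ≤ b) (hd : ∀ e, IsRoundedSemimeasure b (d e)) (σ : List Bool) :
    mixture b d σ ≤ 2 * b ^ (2 * σ.length) :=
  calc mixture b d σ
    _ ≤ ∑ e ∈ Finset.range σ.length, b ^ (σ.length - e) * b ^ σ.length := by
      unfold mixture
      gcongr with e
      exact (hd e).le_pow σ
    _ = (∑ e ∈ Finset.range σ.length, b ^ (σ.length - e)) * b ^ σ.length := by
      rw [Finset.sum_mul]
    _ ≤ 2 * b ^ σ.length * b ^ σ.length := by gcongr; exact sum_range_pow_sub_le hb _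
    _ = 2 * b ^ (2 * σ.length) := by ring

theorem mixture_append_add_le_pow (hb : 2 ≤ b) (hd : ∀ e, IsRoundedSemimeasure b (d e))
    (σ : List Bool) :
    mixture b d (σ ++ [false]) + mixture b d (σ ++ [true]) ≤ 4 * b ^ (2 * (σ.length + 1)) := by
  have hchild (β : Bool) := mixture_le hb hd (σ ++ [β])
  simp only [List.length_append, List.length_singleton] at hchild
  linarith [hchild false, hchild true]

theorem mixture_append_add_le (hb : 2 ≤ b) (hd : ∀ e, IsRoundedSemimeasure b (d e))
    (σ : List Bool) :
    mixture b d (σ ++ [false]) + mixture b d (σ ++ [true]) ≤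
      b ^ 2 * mixture b d σ + 4 * b ^ (σ.length + 2) := by
  set n := σ.length
  have hnew : d n (σ ++ [false]) + d n (σ ++ [true]) ≤ 2 * b ^ (n + 1) := by
    have hle (β : Bool) : d n (σ ++ [β]) ≤ b ^ (n + 1) := by
      simpa [n] using (hd n).le_pow (σ ++ [β])
    linarith [hle false, hle true]
  calc mixture b d (σ ++ [false]) + mixture b d (σ ++ [true])
    _ = b * (∑ e ∈ Finset.range n, b ^ (n - e) * (d e (σ ++ [false]) + d e (σ ++ [true])) +
          (d n (σ ++ [false]) + d n (σ ++ [true]))) := by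
      rw [mixture_append, mixture_append, ← mul_add, ← Finset.sum_add_distrib,
        Finset.sum_range_succ]
      simp only [n, mul_add, Nat.sub_self, pow_zero, one_mul]
    _ ≤ b * (∑ e ∈ Finset.range n, b ^ (n - e) * (b * d e σ + 2) + 2 * b ^ (n + 1)) := by
      exact Nat.mul_le_mul_left b (Nat.add_le_add (Finset.sum_le_sum fun e _ =>
        Nat.mul_le_mul_left _ ((hd e).superadditiveAt σ)) hnew)
    _ = b ^ 2 * mixture b d σ + 2 * b * ∑ e ∈ Finset.range n, b ^ (n - e) +
          2 * b ^ (n + 2) := by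
      simp only [mul_add, Finset.sum_add_distrib, mixture, Finset.mul_sum, mul_left_comm _ b]
      simp only [← Finset.mul_sum, ← Finset.sum_mul, n]
      ring
    _ ≤ b ^ 2 * mixture b d σ + 2 * b * (2 * b ^ n) + 2 * b ^ (n + 2) := by
      gcongr
      exact sum_range_pow_sub_le hb n
    _ = b ^ 2 * mixture b d σ + 2 * (2 * b ^ (n + 1)) + 2 * b ^ (n + 2) := by ring
    _ ≤ b ^ 2 * mixture b d σ + 2 * (b * b ^ (n + 1)) + 2 * b ^ (n + 2) := by gcongr
    _ = b ^ 2 * mixture b d σ + 4 * b ^ (n + 2) := by ring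

end

/-! ### The path of least mass -/

/-- The bit `β` for which `T (σ ++ [β])` is the smaller one relative to the conditional Bernoulli
probability of `β`, where `p` is replaced by its lower approximation with denominator
`b ^ (|σ| + 1)` so that the choice is computable from `p`. -/
noncomputable def lighterBit (b : ℕ) (p : ℝ) (T : List Bool → ℕ) (σ : List Bool) : Bool :=
  decide ((T (σ ++ [false]) + T (σ ++ [true])) * ⌊p * b ^ (σ.length + 1)⌋₊ <
    T (σ ++ [false]) * b ^ (σ.length + 1))

theorem computableIn_lighterBit {O : Set (ℕ →. ℕ)} {b : ℕ} {p : ℝ} {T : List Bool → ℕ}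
    (hp : ComputableIn O fun n : ℕ => ⌊p * (b : ℝ) ^ n⌋₊) (hT : ComputableIn O T) :
    ComputableIn O (lighterBit b p T) := by
  have hchild (β : Bool) : ComputableIn O fun σ : List Bool => T (σ ++ [β]) :=
    computableIn_comp hT (computableIn_append ComputableIn.id (ComputableIn.const β))
  have hlen : ComputableIn O fun σ : List Bool => σ.length + 1 :=
    (Primrec.succ.comp Primrec.list_length).computableIn
  exact computableIn_primrec_comp₂ (f := fun m n : ℕ => decide (m < n)) Primrec.nat_lt.decide
    (computableIn_primrec_comp₂ Primrec.nat_mul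
      (computableIn_primrec_comp₂ Primrec.nat_add (hchild false) (hchild true))
      (computableIn_comp (f := fun n : ℕ => ⌊p * (b : ℝ) ^ n⌋₊) hp hlen))
    (computableIn_primrec_comp₂ Primrec.nat_mul (hchild false)
      (computableIn_pow (ComputableIn.const b) hlen))

theorem apply_append_lighterBit_le {b : ℕ} (hb : 0 < b) {p : ℝ} (hp : 0 ≤ p)
    (T : List Bool → ℕ) (σ : List Bool) :
    (T (σ ++ [lighterBit b p T σ]) : ℝ) ≤ ((T (σ ++ [false]) : ℝ) + T (σ ++ [true])) *
      ((if lighterBit b p T σ then 1 - p else p) + 1 / b ^ (σ.length + 1)) := by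
  set B : ℝ := (b : ℝ) ^ (σ.length + 1)
  have hB : 0 < B := by positivity
  have hfloor_le : (⌊p * B⌋₊ : ℝ) ≤ p * B := Nat.floor_le (by positivity)
  have hlt_floor : p * B < ⌊p * B⌋₊ + 1 := Nat.lt_floor_add_one _
  set S : ℝ := (T (σ ++ [false]) : ℝ) + T (σ ++ [true]) with hS
  have hS0 : 0 ≤ S := by positivity
  have hiff : lighterBit b p T σ = true ↔ S * ⌊p * B⌋₊ < T (σ ++ [false]) * B := by
    simp only [lighterBit, decide_eq_true_eq, S, B]
    exact_mod_cast Iff.rfl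
  refine le_of_mul_le_mul_right ?_ hB
  rw [mul_assoc, add_mul _ (1 / B), one_div_mul_cancel hB.ne']
  rcases hbit : lighterBit b p T σ with - | -
  · have hle : T (σ ++ [false]) * B ≤ S * ⌊p * B⌋₊ :=
      not_lt.1 fun hlt => Bool.false_ne_true (hbit.symm.trans (hiff.2 hlt))
    refine hle.trans (mul_le_mul_of_nonneg_left ?_ hS0)
    simp only [Bool.false_eq_true, if_false]
    linarith
  · have hgt := hiff.1 hbit
    have hle : T (σ ++ [true]) * B ≤ S * (B - ⌊p * B⌋₊) := by linear_combination hgt + B * hS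
    refine hle.trans (mul_le_mul_of_nonneg_left ?_ hS0)
    simp only [if_true]
    linarith

/-- A supermartingale argument with errors: the errors sum to a multiple of `μ_p` because `μ_p` is
at least `(2 / b) ^ n` on strings of length `n`. -/
theorem le_mul_bernoulli_of_step {b : ℕ} {p : unitInterval} (h0 : 2 / (b : ℝ) ≤ p)
    (h1 : 2 / (b : ℝ) ≤ 1 - p) {x : ℕ → Bool} {D : List Bool → ℝ} (hD : D [] ≤ 0)
    (hstep : ∀ n, D (restrict x (n + 1)) ≤
      (D (restrict x n) + 4 / b ^ n) * (if x n then 1 - (p : ℝ) else p) + 4 / b ^ (n + 1))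
    (n : ℕ) : D (restrict x n) ≤ 12 * (bernoulli p).real (cylinder (restrict x n)) := by
  set m : ℕ → ℝ := fun n => (bernoulli p).real (cylinder (restrict x n)) with hm
  have hsmall (n : ℕ) : 1 / (b : ℝ) ^ n ≤ (1 / 2) ^ n * m n := by
    simpa only [length_restrict] using one_div_pow_length_le h0 h1 (restrict x n)
  have hbound : D (restrict x n) ≤ 12 * (1 - (1 / 2) ^ n) * m n := by
    induction n with
    | zero => simpa [restrict] using hD
    | succ n ih =>
      set w : ℝ := if x n then 1 - (p : ℝ) else p with hw
      have hw0 : 0 ≤ w := bernoulli_bit_nonneg p (x n)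
      have hmul : m (n + 1) = m n * w := by
        simp only [hm, hw, restrict_succ, bernoulli_real_cylinder_append]
      calc D (restrict x (n + 1))
        _ ≤ (D (restrict x n) + 4 * (1 / b ^ n)) * w + 4 * (1 / b ^ (n + 1)) := by
          simpa only [mul_one_div] using hstep n
        _ ≤ (12 * (1 - (1 / 2) ^ n) * m n + 4 * ((1 / 2) ^ n * m n)) * w +
              4 * ((1 / 2) ^ (n + 1) * m (n + 1)) := by
          gcongr
          exacts [hsmall n, hsmall (n + 1)]
        _ = 12 * (1 - (1 / 2) ^ (n + 1)) * m (n + 1) := by rw [hmul]; ring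
  have hm0 : 0 ≤ m n := measureReal_nonneg
  have hpow : (0 : ℝ) ≤ (1 / 2) ^ n := by positivity
  nlinarith [mul_nonneg hpow hm0]

theorem mixture_append_lighterBit_le {b : ℕ} (hb : 2 ≤ b) (p : unitInterval)
    {d : ℕ → List Bool → ℕ} (hd : ∀ e, IsRoundedSemimeasure b (d e)) {σ : List Bool} {β : Bool}
    (hβ : β = lighterBit b p (mixture b d) σ) :
    (mixture b d (σ ++ [β]) : ℝ) / b ^ (2 * (σ.length + 1)) ≤
      (mixture b d σ / b ^ (2 * σ.length) + 4 / b ^ σ.length) *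
        (if β then 1 - (p : ℝ) else p) + 4 / b ^ (σ.length + 1) := by
  have hb0 : 0 < b := by omega
  have hlighter := apply_append_lighterBit_le hb0 p.2.1 (mixture b d) σ
  rw [← hβ] at hlighter
  set n := σ.length
  set w : ℝ := if β then 1 - (p : ℝ) else p
  have hw0 : 0 ≤ w := bernoulli_bit_nonneg p β
  set S : ℝ := (mixture b d (σ ++ [false]) : ℝ) + mixture b d (σ ++ [true]) with hS
  have hadd : S ≤ b ^ 2 * mixture b d σ + 4 * b ^ (n + 2) := by
    rw [hS]
    exact_mod_cast mixture_append_add_le hb hd σ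
  have hle : S ≤ 4 * b ^ (2 * (n + 1)) := by
    rw [hS]
    exact_mod_cast mixture_append_add_le_pow hb hd σ
  rw [div_le_iff₀ (by positivity)]
  calc (mixture b d (σ ++ [β]) : ℝ)
    _ ≤ S * w + S * (1 / b ^ (n + 1)) := by rwa [← mul_add]
    _ ≤ (b ^ 2 * mixture b d σ + 4 * b ^ (n + 2)) * w +
          4 * b ^ (2 * (n + 1)) * (1 / b ^ (n + 1)) := by gcongr
    _ = ((mixture b d σ / b ^ (2 * n) + 4 / b ^ n) * w + 4 / b ^ (n + 1)) *
          b ^ (2 * (n + 1)) := by field_simp; ring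

theorem mixture_follow_lighterBit_le {b : ℕ} (hb : 2 ≤ b) {p : unitInterval}
    (h0 : 2 / (b : ℝ) ≤ p) (h1 : 2 / (b : ℝ) ≤ 1 - p) {d : ℕ → List Bool → ℕ}
    (hd : ∀ e, IsRoundedSemimeasure b (d e)) {y : ℕ → Bool}
    (hy : y = follow (lighterBit b p (mixture b d))) (n : ℕ) :
    (mixture b d (restrict y n) : ℝ) ≤
      12 * b ^ (2 * n) * (bernoulli p).real (cylinder (restrict y n)) := by
  have hstep (n : ℕ) := mixture_append_lighterBit_le hb p hd (σ := restrict y n) (β := y n)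
    (by rw [hy]; exact follow_apply _ _)
  simp only [← restrict_succ, length_restrict] at hstep
  have hmain := le_mul_bernoulli_of_step (x := y) h0 h1
    (D := fun σ => mixture b d σ / (b : ℝ) ^ (2 * σ.length)) (by simp [mixture])
    (by simpa only [length_restrict] using hstep) n
  rw [length_restrict, div_le_iff₀ (pow_pos (by exact_mod_cast two_pos.trans_le hb) _)] at hmain
  linarith

theorem div_bernoulli_le_of_mixture_le {b : ℕ} (hb : 0 < b) {p : unitInterval}
    (hp : (p : ℝ) ∈ Set.Ioo (0 : ℝ) 1) {d : ℕ → List Bool → ℕ} {f : List Bool → ℝ} {e : ℕ}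
    {σ : List Bool} (hf : b ^ σ.length * f σ ≤ d e σ) (he : e < σ.length) {K : ℝ}
    (hK : (mixture b d σ : ℝ) ≤ K * b ^ (2 * σ.length) * (bernoulli p).real (cylinder σ)) :
    f σ / (bernoulli p).real (cylinder σ) ≤ K * b ^ e := by
  rw [div_le_iff₀ (bernoulli_real_cylinder_pos hp σ)]
  obtain ⟨k, hk⟩ := Nat.exists_eq_add_of_le he.le
  refine le_of_mul_le_mul_left ?_ (show (0 : ℝ) < b ^ k * b ^ σ.length by positivity)
  calc (b : ℝ) ^ k * b ^ σ.length * f σ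
    _ = b ^ (σ.length - e) * (b ^ σ.length * f σ) := by
      rw [mul_assoc, show σ.length - e = k by omega]
    _ ≤ b ^ (σ.length - e) * d e σ := by gcongr
    _ ≤ mixture b d σ := by exact_mod_cast pow_mul_le_mixture b d he
    _ ≤ K * b ^ (2 * σ.length) * (bernoulli p).real (cylinder σ) := hK
    _ = b ^ k * b ^ σ.length * (K * b ^ e * (bernoulli p).real (cylinder σ)) := by
      rw [two_mul, pow_add]
      nth_rewrite 1 [hk]
      ring

theorem not_succeeds_of_eventually_le {M : List Bool → ℝ} {x : ℕ → Bool} {K : ℝ}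
    (h : ∀ᶠ n in atTop, M (restrict x n) ≤ K) : ¬ Succeeds M x := by
  have hle : limsup (fun n => (M (restrict x n) : EReal)) atTop ≤ (K : EReal) :=
    limsup_le_of_le (h := h.mono fun n hn => EReal.coe_le_coe_iff.2 hn)
  exact (hle.trans_lt (EReal.coe_lt_top K)).ne

theorem not_succeeds_follow_lighterBit {b : ℕ} (hb : 2 ≤ b) {p : unitInterval}
    (hp : (p : ℝ) ∈ Set.Ioo (0 : ℝ) 1) (h0 : 2 / (b : ℝ) ≤ p) (h1 : 2 / (b : ℝ) ≤ 1 - p)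
    {M : List Bool → ℝ} (hM : IsBlindSupermartingale p M) :
    ¬ Succeeds M
      (follow (lighterBit b p (mixture b fun e => trim b (countBelow b e)))) := by
  have hb0 : 0 < b := by omega
  obtain ⟨δ, hδ, hce, hMδ⟩ := hM
  obtain ⟨e, he⟩ := exists_countBelow_eq_roundUp hb0 hδ hce
  have htrim : trim b (countBelow b e) = roundUp b δ := by
    rw [he, trim_eq_self (isRoundedSemimeasure_roundUp b hδ)]
  refine not_succeeds_of_eventually_le (K := 12 * b ^ e) ?_
  filter_upwards [eventually_gt_atTop e] with n hn
  rw [hMδ]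
  refine div_bernoulli_le_of_mixture_le (d := fun e => trim b (countBelow b e)) hb0 hp
    (by rw [htrim]; exact Nat.le_ceil _) (by rwa [length_restrict]) ?_
  simpa only [length_restrict] using mixture_follow_lighterBit_le hb h0 h1
    (fun e => isRoundedSemimeasure_trim (countBelow_le b e)) rfl n

theorem computableIn_follow_lighterBit {O : Set (ℕ →. ℕ)} {x : ℝ} (l : ℕ)
    (hjump : ComputableIn O emptyJump) (hx : ComputableIn O (binaryExpansion x)) :
    ComputableIn O (follow (lighterBit (2 ^ l) x
      (mixture (2 ^ l) fun e => trim (2 ^ l) (countBelow (2 ^ l) e)))) := by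
  refine computableIn_follow (computableIn_lighterBit ?_ (computableIn_mixture _
    (computableIn_trim _ (computableIn_countBelow hjump _))))
  simp only [Nat.cast_pow, Nat.cast_ofNat, ← pow_mul]
  exact computableIn_comp (f := fun n : ℕ => ⌊x * 2 ^ n⌋₊) (g := fun n => l * n)
    (computableIn_floor_mul_two_pow hx)
    (Primrec.nat_mul.comp (Primrec.const l) Primrec.id).computableIn

theorem exists_two_div_two_pow_le {r : ℝ} (hr : 0 < r) :
    ∃ l : ℕ, 2 / ((2 ^ l : ℕ) : ℝ) ≤ r := by
  obtain ⟨l, hl⟩ := pow_unbounded_of_one_lt (2 / r) one_lt_two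
  refine ⟨l, ?_⟩
  push_cast
  rw [div_le_comm₀ (by positivity) hr]
  exact hl.le

theorem exists_computableIn_not_succeeds {O : Set (ℕ →. ℕ)} {p : unitInterval}
    (hp : (p : ℝ) ∈ Set.Ioo (0 : ℝ) 1) (hjump : ComputableIn O emptyJump)
    (hpO : ComputableIn O (binaryExpansion p)) :
    ∃ y : ℕ → Bool, ComputableIn O y ∧
      ∀ M : List Bool → ℝ, IsBlindSupermartingale p M → ¬ Succeeds M y := by
  obtain ⟨l, hl⟩ := exists_two_div_two_pow_le (lt_min hp.1 (sub_pos.2 hp.2))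
  have h0 := hl.trans (min_le_left _ _)
  have h1 := hl.trans (min_le_right _ _)
  have hb : 2 ≤ 2 ^ l := by
    have := h0.trans p.2.2
    rw [div_le_one (by positivity)] at this
    exact_mod_cast this
  exact ⟨_, computableIn_follow_lighterBit l hjump hpO,
    fun M hM => not_succeeds_follow_lighterBit hb hp h0 h1 hM⟩

end BlindBernoulli

open BlindBernoulli in
theorem mainTheorem10_general (p : unitInterval) (hp : (p : ℝ) ∈ Set.Ioo (0 : ℝ) 1) (z : ℕ → Bool)
    (hjump : TuringReducible (toOracle emptyJump) (toOracle z))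
    (hpz : TuringReducible (toOracle (binaryExpansion p)) (toOracle z)) :
    ∃ y : ℕ → Bool, y ∉ MLR (bernoulli p) z ∧
      ∀ M : List Bool → ℝ, IsBlindSupermartingale p M → ¬ Succeeds M y := by
  obtain ⟨y, hy, hbounded⟩ := exists_computableIn_not_succeeds hp
    (recursiveIn_toOracle_iff.1 hjump) (recursiveIn_toOracle_iff.1 hpz)
  exact ⟨y, not_mem_MLR_bernoulli_of_computableIn hp hy, hbounded⟩

theorem mainTheorem10 (p : unitInterval)
    (hp : TuringReducible (BlindBernoulli.toOracle BlindBernoulli.emptyJump)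
      (BlindBernoulli.toOracle (BlindBernoulli.binaryExpansion p))) :
    ∃ y : ℕ → Bool, y ∉ BlindBernoulli.BernoulliRandom p ∧
      ∀ M : List Bool → ℝ, BlindBernoulli.IsBlindSupermartingale p M →
        ¬ BlindBernoulli.Succeeds M y :=
  mainTheorem10_general p (BlindBernoulli.mem_Ioo_of_emptyJump_le hp) _ hp TuringReducible.rfl
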